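/- Conventions. A (reversed) well-founded tree is a well-founded partially ordered set $(T,\le)$ such that, for every $t\in T$, the set $\{s\in T\mid t<s\}$ of all successors of $t$ is finite and linearly ordered. "Countable" means finite or denumerably infinite. For ordinals $\alpha,\beta$, let $\alpha\oplus\beta$ be their (Hessenberg) natural sum, obtained by adding the Cantor normal forms of $\alpha$ and $\beta$ coefficient by coefficient. For a sequence $(\alpha_\gamma)_{\gamma<\zeta}$ of ordinals, define $S_\delta$ for $\delta\le\zeta$ by $S_0=0$, $S_{\delta+1}=S_\delta\oplus\alpha_\delta$, and $S_\delta=\sup_{\delta'<\delta}S_{\delta'}$ for $\delta$ limit; $S_\zeta$ is the iterated natural sum of the sequence. For a family $(\alpha_i)_{i\in I}$ of ordinals indexed by an arbitrary set $I$, its infinitary natural sum $\bigoplus_{i\in I}\alpha_i$ is the least of the iterated natural sums of the sequences $(\alpha_{f(\gamma)})_{\gamma<\zeta}$, where $\zeta$ varies among the ordinals of cardinality $|I|$ and $f$ among the bijections from $\zeta$ to $I$. For a well-founded tree $T$, the size of $t\in T$ is defined by well-founded recursion as $$\sigma(t)=\Bigl(\bigoplus_{u\in P(t)}\sigma(u)\Bigr)+1,$$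 where $P(t)$ is the set of all immediate predecessors of $t$, and the size of $T$ is $\sigma(T)=\bigoplus_{t\in M}\sigma(t)$, where $M$ is the set of the maximal elements of $T$. An order $\le'$ on $T$ is a downward-finite extension of $\le$ if $u\le t$ implies $u\le' t$ for all $u,t\in T$ and, for every $v\in T$, there is a finite (possibly empty) set $F$ of elements of $T$, each $\le$-incomparable with $v$, such that $$\{w\in T\mid w\le' v\}\subseteq\{w\in T\mid w\le v\}\cup\bigcup_{u\in F}\{w\in T\mid w\le u\}.$$ Theorem. Let $(T,\le)$ be a countable well-founded (reversed) tree. Then $\le$ has a downward-finite extension which is a well-order of order type $\sigma(T)$. Moreover, every downward-finite extension of $\le$ which is a well-order has order type at most $\sigma(T)$. -/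

import Mathlib

universe u

namespace TreeSize

open Ordinal

/-- The (Hessenberg) natural sum of two ordinals: the Cantor normal forms (in base `ω`) of the two
ordinals are added coefficient by coefficient. All coefficients are `< ω`, that is, natural numbers,
and so are their sums. -/
noncomputable def natAdd (α β : Ordinal.{u}) : Ordinal.{u} :=
  CNF.eval ω (CNF.coeff ω α + CNF.coeff ω β)

/-- The iterated natural sum `∑_{γ < δ} a γ`: natural sum at successor steps, supremum at limits.
Only the values `a γ` with `γ < δ` matter. -/
noncomputable def iterNatSum (a : Ordinal.{u} → Ordinal.{u}) (δ : Ordinal.{u}) : Ordinal.{u} :=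
  Ordinal.limitRecOn δ 0 (fun γ s => natAdd s (a γ))
    (fun δ _ s => ⨆ γ : Set.Iio δ, s γ.1 γ.2)

theorem iterNatSum_zero (a : Ordinal.{u} → Ordinal.{u}) : iterNatSum a 0 = 0 := by
  simp [iterNatSum]

theorem iterNatSum_add_one (a : Ordinal.{u} → Ordinal.{u}) (δ : Ordinal.{u}) :
    iterNatSum a (δ + 1) = natAdd (iterNatSum a δ) (a δ) := by
  simp [iterNatSum]

theorem iterNatSum_limit (a : Ordinal.{u} → Ordinal.{u}) {δ : Ordinal.{u}}
    (h : Order.IsSuccLimit δ) : iterNatSum a δ = ⨆ γ : Set.Iio δ, iterNatSum a γ.1 := by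
  simp [iterNatSum, Ordinal.limitRecOn_limit _ _ _ _ h]

open Classical in
/-- The family `α` on `I`, rearranged into a sequence of length `ζ` by a bijection `f` from (the set
of ordinals below) `ζ` onto `I`; the irrelevant values at ordinals `≥ ζ` are set to `0`. -/
noncomputable def rearrange {I : Type u} (α : I → Ordinal.{u}) {ζ : Ordinal.{u}}
    (f : Set.Iio ζ ≃ I) (γ : Ordinal.{u}) : Ordinal.{u} :=
  if h : γ < ζ then α (f ⟨γ, h⟩) else 0

/-- All the values of iterated natural sums of rearrangements of the family `α`. -/
def rearrangedSums {I : Type u} (α : I → Ordinal.{u}) : Set Ordinal.{u} :=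
  {s | ∃ (ζ : Ordinal.{u}) (f : Set.Iio ζ ≃ I), s = iterNatSum (rearrange α f) ζ}

/-- The infimum in the definition of the infinitary natural sum is over a nonempty set. -/
theorem rearrangedSums_nonempty {I : Type u} (α : I → Ordinal.{u}) :
    (rearrangedSums α).Nonempty := by
  have e : Set.Iio (Ordinal.type (WellOrderingRel (α := I))) ≃ I :=
    (Ordinal.enum (WellOrderingRel (α := I))).toEquiv
  exact ⟨_, _, e, rfl⟩

/-- The (permutation invariant) infinitary natural sum of a family of ordinals indexed by an
arbitrary set: the least iterated natural sum, over all rearrangements of the family into a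
transfinite sequence. -/
noncomputable def natSum {I : Type u} (α : I → Ordinal.{u}) : Ordinal.{u} :=
  sInf (rearrangedSums α)

/-- A (reversed) tree, for a partial order assumed to be well-founded separately: the set of
the (strict) successors of each element is finite and linearly ordered. -/
structure IsReversedTree (T : Type u) [PartialOrder T] : Prop where
  finite_successors : ∀ t : T, (Set.Ioi t).Finite
  chain_successors : ∀ t : T, IsChain (· ≤ ·) (Set.Ioi t)

/-- The size of an element `t`: the natural sum of the sizes of the immediate predecessors
of `t`, plus one. -/
noncomputable def nodeSize {T : Type u} [PartialOrder T] [WellFoundedLT T] (t : T) : Ordinal.{u} :=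
  natSum (fun u : {u : T // u ⋖ t} => nodeSize u.1) + 1
termination_by (wellFounded_lt (α := T)).wrap t
decreasing_by exact u.2.lt

/-- The size of a tree: the natural sum of the sizes of its maximal elements. -/
noncomputable def size (T : Type u) [PartialOrder T] [WellFoundedLT T] : Ordinal.{u} :=
  natSum (fun t : {t : T // IsMax t} => nodeSize t.1)

/-- The order relation `le'` is a downward-finite extension of the given partial order on `T`:
it extends `≤`, and, for every `v`, the set of the elements `le'`-below `v` is contained in the
union of the `≤`-down-set of `v` and of the `≤`-down-sets of finitely many (possibly no) elements
that are `≤`-incomparable with `v`. -/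
structure IsDownwardFiniteExtension {T : Type u} [PartialOrder T] (le' : T → T → Prop) : Prop where
  extends_le : ∀ u t : T, u ≤ t → le' u t
  downward_finite : ∀ v : T, ∃ F : Finset T, (∀ u ∈ F, ¬ u ≤ v ∧ ¬ v ≤ u) ∧
    {w | le' w v} ⊆ Set.Iic v ∪ ⋃ u ∈ F, Set.Iic u

end TreeSize

namespace TreeSize

open Ordinal Set

/-! ### Natural addition: order, and compatibility with ordinary addition -/

section NatAdd

/-! Upper bound. In a well-order that is a downward-finite extension, the elements of a forest up to
a given one meet only finitely many components. A finite union has type at most the natural sum of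
the types (`otp_union_le`), and a finite subfamily is bounded by any iterated natural sum of the
whole family (`otp_biUnion_le_natSum`). So all initial segments, and hence the forest, have type at
most the infinitary natural sum. A node comes last in its down-set, which accounts for the `+ 1` in
`nodeSize`; well-founded induction then gives `type_le_size`.

Existence. It suffices to reach a type at least `size T`, since the upper bound then forces
equality. By the same induction, the task is to interleave countably many well-ordered components
into type at least their natural sum, so that every proper initial segment meets finitely many of
them. Finitely many ordinals can be shuffled into exactly their natural sum
(`exists_isPairMerge_natAdd`). For an ω-sequence, let S = ρ + ω^ξ be the supremum of the partial
natural sums, ω^ξ being its last Cantor term. Shuffle the first n components, n so large that their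
sum exceeds ρ, and append the others one after another: the result is at least S
(`exists_partialSum_le_iSup_tailSum`). -/

theorem coeff_lt_omega0 (o e : Ordinal.{u}) : CNF.coeff ω o e < ω := by
  by_cases h : e ∈ (CNF ω o).map Prod.fst
  · obtain ⟨⟨x, c⟩, hx, rfl⟩ := List.mem_map.1 h
    rw [CNF.coeff_of_mem_CNF hx]
    exact CNF.snd_lt one_lt_omega0 hx
  · rw [CNF.coeff_of_notMem_CNF h]
    exact omega0_pos

theorem coeff_natAdd (a b : Ordinal.{u}) :
    CNF.coeff ω (natAdd a b) = CNF.coeff ω a + CNF.coeff ω b :=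
  CNF.coeff_eval one_lt_omega0 fun e =>
    isPrincipal_add_omega0 (coeff_lt_omega0 a e) (coeff_lt_omega0 b e)

theorem coeff_add_comm (a b : Ordinal.{u}) :
    CNF.coeff ω a + CNF.coeff ω b = CNF.coeff ω b + CNF.coeff ω a := by
  ext e
  obtain ⟨m, hm⟩ := lt_omega0.1 (coeff_lt_omega0 a e)
  obtain ⟨n, hn⟩ := lt_omega0.1 (coeff_lt_omega0 b e)
  rw [Finsupp.add_apply, Finsupp.add_apply, hm, hn]
  exact_mod_cast add_comm m n

theorem natAdd_comm (a b : Ordinal.{u}) : natAdd a b = natAdd b a := by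
  rw [natAdd, natAdd, coeff_add_comm]

theorem natAdd_assoc (a b c : Ordinal.{u}) :
    natAdd (natAdd a b) c = natAdd a (natAdd b c) := by
  have h₁ : natAdd (natAdd a b) c = CNF.eval ω (CNF.coeff ω (natAdd a b) + CNF.coeff ω c) := rfl
  have h₂ : natAdd a (natAdd b c) = CNF.eval ω (CNF.coeff ω a + CNF.coeff ω (natAdd b c)) := rfl
  rw [h₁, h₂, coeff_natAdd, coeff_natAdd, add_assoc]

@[simp]
theorem natAdd_zero (a : Ordinal.{u}) : natAdd a 0 = a := by
  simp [natAdd]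

@[simp]
theorem zero_natAdd (a : Ordinal.{u}) : natAdd 0 a = a := by
  simp [natAdd]

theorem eval_eq_split (f : Ordinal.{u} →₀ Ordinal.{u}) (e : Ordinal.{u}) :
    CNF.eval ω f = CNF.eval ω (f.filter (e < ·)) +
      (ω ^ e * f e + CNF.eval ω (f.filter (· < e))) := by
  classical
  rw [← CNF.eval_single_add', ← CNF.eval_add]
  · congr 1
    ext x
    simp only [Finsupp.add_apply, Finsupp.filter_apply, Finsupp.single_apply]
    rcases lt_trichotomy x e with h | h | h
    · simp [h, h.ne', h.not_gt]
    · simp [h]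
    · simp [h, h.ne, h.not_gt]
  · intro x hx y hy
    have hx' : e < x := by
      rw [Finsupp.support_filter, Finset.mem_filter] at hx
      exact hx.2
    refine le_trans ?_ hx'.le
    rcases Finset.mem_union.1 (Finsupp.support_add hy) with h | h
    · exact (Finset.mem_singleton.1 (Finsupp.support_single_subset h)).le
    · rw [Finsupp.support_filter, Finset.mem_filter] at h
      exact h.2.le
  · intro y hy
    rw [Finsupp.support_filter, Finset.mem_filter] at hy
    exact hy.2

/-- The terms above `e` agree and those of `f` below `e` together stay under `ω ^ e`, so the
coefficient at `e` decides. -/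
theorem eval_lt_eval {f g : Ordinal.{u} →₀ Ordinal.{u}} (hf : ∀ e, f e < ω) {e : Ordinal.{u}}
    (he : f e < g e) (h : ∀ x, e < x → f x = g x) : CNF.eval ω f < CNF.eval ω g := by
  classical
  have hfg : f.filter (e < ·) = g.filter (e < ·) := by
    ext x
    simp only [Finsupp.filter_apply]
    split_ifs with hx
    · exact h x hx
    · rfl
  rw [eval_eq_split f e, eval_eq_split g e, hfg]
  refine add_lt_add_right ?_ _
  have hlo : CNF.eval ω (f.filter (· < e)) < ω ^ e := by
    refine CNF.eval_lt (fun x => ?_) fun x hx => ?_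
    · rw [Finsupp.filter_apply]
      split_ifs
      exacts [hf x, omega0_pos]
    · rw [Finsupp.support_filter, Finset.mem_filter] at hx
      exact hx.2
  calc ω ^ e * f e + CNF.eval ω (f.filter (· < e)) < ω ^ e * f e + ω ^ e :=
        add_lt_add_right hlo _
    _ = ω ^ e * (f e + 1) := by rw [mul_add_one]
    _ ≤ ω ^ e * g e := by gcongr; exact Order.add_one_le_of_lt he
    _ ≤ _ := le_self_add

/-- Take the largest exponent at which the normal forms differ; by `eval_lt_eval` the coefficients
there cannot compare the other way. Normal forms are thus ordered lexicographically, which makes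
`natAdd` strictly monotone. -/
theorem exists_coeff_lt {a b : Ordinal.{u}} (h : a < b) :
    ∃ e, CNF.coeff ω a e < CNF.coeff ω b e ∧
      ∀ x, e < x → CNF.coeff ω a x = CNF.coeff ω b x := by
  classical
  set f := CNF.coeff ω a
  set g := CNF.coeff ω b
  let D := (f.support ∪ g.support).filter fun x => f x ≠ g x
  have hD : D.Nonempty := by
    by_contra hD
    rw [Finset.not_nonempty_iff_eq_empty] at hD
    refine h.ne ((CNF.coeff_inj (b := ω)).1 (Finsupp.ext fun x => ?_))
    by_contra hx
    have : x ∈ D := by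
      simp only [D, Finset.mem_filter, Finset.mem_union, Finsupp.mem_support_iff]
      refine ⟨?_, hx⟩
      by_contra! h0
      exact hx (h0.1.trans h0.2.symm)
    simp [hD] at this
  let e := D.max' hD
  have he : f e ≠ g e := (Finset.mem_filter.1 (D.max'_mem hD)).2
  have hgt : ∀ x, e < x → f x = g x := by
    intro x hx
    by_contra hne
    have : x ∈ D := by
      simp only [D, Finset.mem_filter, Finset.mem_union, Finsupp.mem_support_iff]
      refine ⟨?_, hne⟩
      by_contra! h0
      exact hne (h0.1.trans h0.2.symm)
    exact (D.le_max' x this).not_gt hx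
  refine ⟨e, lt_of_le_of_ne (not_lt.1 fun hlt => ?_) he, hgt⟩
  have := eval_lt_eval (coeff_lt_omega0 b) hlt fun x hx => (hgt x hx).symm
  rw [CNF.eval_coeff, CNF.eval_coeff] at this
  exact this.not_gt h

theorem natAdd_lt_natAdd_left {a b : Ordinal.{u}} (h : a < b) (c : Ordinal.{u}) :
    natAdd c a < natAdd c b := by
  obtain ⟨e, he, hgt⟩ := exists_coeff_lt h
  refine eval_lt_eval (e := e) (fun e =>
    isPrincipal_add_omega0 (coeff_lt_omega0 c e) (coeff_lt_omega0 a e)) ?_ fun x hx => ?_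
  · simpa using he
  · simp [hgt x hx]

theorem natAdd_lt_natAdd_right {a b : Ordinal.{u}} (h : a < b) (c : Ordinal.{u}) :
    natAdd a c < natAdd b c := by
  rw [natAdd_comm a, natAdd_comm b]
  exact natAdd_lt_natAdd_left h c

theorem natAdd_le_natAdd {a b c d : Ordinal.{u}} (h : a ≤ b) (h' : c ≤ d) :
    natAdd a c ≤ natAdd b d :=
  ((strictMono_id.monotone.comp (StrictMono.monotone fun _ _ h => natAdd_lt_natAdd_right h c)) h
    : natAdd a c ≤ natAdd b c).trans
    ((StrictMono.monotone fun _ _ h => natAdd_lt_natAdd_left h b) h')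

theorem left_le_natAdd (a b : Ordinal.{u}) : a ≤ natAdd a b := by
  simpa using natAdd_le_natAdd (le_refl a) (zero_le (a := b))

/-- All exponents in the Cantor normal form of `a` are at least `e`. -/
def ExponentsGE (e a : Ordinal.{u}) : Prop := ∀ x ∈ (CNF.coeff ω a).support, e ≤ x

/-- All exponents in the Cantor normal form of `a` are at most `e`. -/
def ExponentsLE (e a : Ordinal.{u}) : Prop := ∀ x ∈ (CNF.coeff ω a).support, x ≤ e

theorem ExponentsGE.mono {e e' a : Ordinal.{u}} (h : ExponentsGE e a) (h' : e' ≤ e) :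
    ExponentsGE e' a := fun x hx => h'.trans (h x hx)

theorem exponentsGE_zero (e : Ordinal.{u}) : ExponentsGE e 0 := by simp [ExponentsGE]

theorem exponentsLE_zero (e : Ordinal.{u}) : ExponentsLE e 0 := by simp [ExponentsLE]

theorem support_lt_of_lt_opow {e a : Ordinal.{u}} (h : a < ω ^ e) :
    ∀ x ∈ (CNF.coeff ω a).support, x < e := by
  intro x hx
  by_contra! hle
  rw [Finsupp.mem_support_iff] at hx
  exact hx (CNF.coeff_eq_zero_of_lt (h.trans_le (opow_le_opow_right omega0_pos hle)))

theorem exponentsLE_of_lt {e a : Ordinal.{u}} (h : a < ω ^ e) : ExponentsLE e a :=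
  fun x hx => (support_lt_of_lt_opow h x hx).le

theorem coeff_opow (e : Ordinal.{u}) : CNF.coeff ω (ω ^ e) = Finsupp.single e 1 := by
  have := CNF.coeff_opow_mul_add (b := ω) (e := e) (x := 1) (y := 0) one_lt_omega0 one_ne_zero
    one_lt_omega0 (opow_pos _ omega0_pos)
  simpa using this

theorem exponentsLE_opow (e : Ordinal.{u}) : ExponentsLE e (ω ^ e) := by
  intro x hx
  rw [coeff_opow] at hx
  exact (Finset.mem_singleton.1 (Finsupp.support_single_subset hx)).le

theorem natAdd_lt_opow {e a b : Ordinal.{u}} (ha : a < ω ^ e) (hb : b < ω ^ e) :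
    natAdd a b < ω ^ e := by
  classical
  refine CNF.eval_lt (fun x => isPrincipal_add_omega0 (coeff_lt_omega0 a x)
    (coeff_lt_omega0 b x)) fun x hx => ?_
  rcases Finset.mem_union.1 (Finsupp.support_add hx) with h | h
  exacts [support_lt_of_lt_opow ha x h, support_lt_of_lt_opow hb x h]

/-- Nothing in `a` is absorbed: the sum concatenates the two normal forms, which overlap at most in
the exponent `e`. -/
theorem coeff_add {e a b : Ordinal.{u}} (ha : ExponentsGE e a) (hb : ExponentsLE e b) :
    CNF.coeff ω (a + b) = CNF.coeff ω a + CNF.coeff ω b := by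
  conv_lhs => rw [← CNF.eval_coeff ω a, ← CNF.eval_coeff ω b]
  rw [← CNF.eval_add, CNF.coeff_eval one_lt_omega0]
  · exact fun x => isPrincipal_add_omega0 (coeff_lt_omega0 a x) (coeff_lt_omega0 b x)
  · exact fun x hx y hy => (hb y hy).trans (ha x hx)

/-- The bridge between the two additions: natural sums may be computed separately above and below a
common cut `e`. -/
theorem natAdd_add_add {e a b c d : Ordinal.{u}} (ha : ExponentsGE e a) (hb : ExponentsLE e b)
    (hc : ExponentsGE e c) (hd : ExponentsLE e d) :
    natAdd (a + b) (c + d) = natAdd a c + natAdd b d := by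
  classical
  have hcomm : CNF.coeff ω (a + b) + CNF.coeff ω (c + d) =
      (CNF.coeff ω a + CNF.coeff ω c) + (CNF.coeff ω b + CNF.coeff ω d) := by
    rw [coeff_add ha hb, coeff_add hc hd, add_assoc, add_assoc,
      ← add_assoc (CNF.coeff ω b), coeff_add_comm b c, add_assoc]
  rw [natAdd, hcomm, CNF.eval_add]
  · rfl
  · intro x hx y hy
    have hx' : e ≤ x := by
      rcases Finset.mem_union.1 (Finsupp.support_add hx) with h | h
      exacts [ha x h, hc x h]
    refine le_trans ?_ hx'
    rcases Finset.mem_union.1 (Finsupp.support_add hy) with h | h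
    exacts [hb y h, hd y h]

/-- Here `e` is the smallest exponent of `a`, and a single copy of `ω ^ e` is split off, so `e` may
still occur in `b`. -/
theorem exists_eq_add_opow {a : Ordinal.{u}} (ha : a ≠ 0) :
    ∃ b e, a = b + ω ^ e ∧ ExponentsGE e b ∧ ExponentsGE e a := by
  classical
  set f := CNF.coeff ω a with hf
  have hne : f.support.Nonempty := by
    rw [Finsupp.support_nonempty_iff]
    intro h0
    apply ha
    rw [← CNF.eval_coeff ω a, ← hf, h0, CNF.eval_zero_right]
  let e := f.support.min' hne
  have hmin : ∀ x ∈ f.support, e ≤ x := fun x hx => f.support.min'_le x hx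
  obtain ⟨n, hn⟩ := lt_omega0.1 (coeff_lt_omega0 a e)
  have hn0 : n ≠ 0 := by
    rintro rfl
    exact Finsupp.mem_support_iff.1 (f.support.min'_mem hne) (by simpa using hn)
  obtain ⟨m, rfl⟩ := Nat.exists_eq_succ_of_ne_zero hn0
  let g := f.update e m
  have hg : ∀ x, g x = if x = e then (m : Ordinal) else f x := fun x => by
    simp [g, Function.update_apply]
  have hglt : ∀ x, g x < ω := fun x => by
    rw [hg]
    split_ifs
    exacts [natCast_lt_omega0 m, coeff_lt_omega0 a x]
  have hgsupp : ∀ x ∈ g.support, e ≤ x := fun x hx => by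
    rw [Finsupp.mem_support_iff, hg] at hx
    split_ifs at hx with h
    exacts [h.ge, hmin x (Finsupp.mem_support_iff.2 hx)]
  have hfg : f = g + Finsupp.single e 1 := by
    ext x
    rw [Finsupp.add_apply, hg, Finsupp.single_apply]
    by_cases h : x = e
    · subst h
      simpa using hn
    · simp [h, Ne.symm h]
  refine ⟨CNF.eval ω g, e, ?_, ?_, hmin⟩
  · conv_lhs => rw [← CNF.eval_coeff ω a, ← hf, hfg]
    rw [CNF.eval_add, CNF.eval_single, mul_one]
    intro x hx y hy
    rw [Finset.mem_singleton.1 (Finsupp.support_single_subset hy)]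
    exact hgsupp x hx
  · intro x hx
    rw [CNF.coeff_eval one_lt_omega0 hglt] at hx
    exact hgsupp x hx

end NatAdd

/-! ### Shuffling ordinals into their natural sum -/

section Merge

/-- The maps `f` and `g` merge the ordinals `a` and `b` into the ordinal `c`. -/
structure IsPairMerge (a b c : Ordinal.{u}) (f g : Ordinal.{u} → Ordinal.{u}) : Prop where
  strictMonoOn_left : StrictMonoOn f (Iio a)
  strictMonoOn_right : StrictMonoOn g (Iio b)
  left_lt : ∀ x < a, f x < c
  right_lt : ∀ x < b, g x < c
  ne : ∀ x < a, ∀ y < b, f x ≠ g y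
  surj : ∀ z < c, (∃ x < a, f x = z) ∨ ∃ y < b, g y = z

theorem IsPairMerge.symm {a b c : Ordinal.{u}} {f g : Ordinal.{u} → Ordinal.{u}}
    (h : IsPairMerge a b c f g) : IsPairMerge b a c g f where
  strictMonoOn_left := h.strictMonoOn_right
  strictMonoOn_right := h.strictMonoOn_left
  left_lt := h.right_lt
  right_lt := h.left_lt
  ne x hx y hy := (h.ne y hy x hx).symm
  surj z hz := (h.surj z hz).symm

theorem IsPairMerge.add_right {a b c : Ordinal.{u}} {f g : Ordinal.{u} → Ordinal.{u}}
    (h : IsPairMerge a b c f g) (d : Ordinal.{u}) :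
    IsPairMerge (a + d) b (c + d) (fun x => if x < a then f x else c + (x - a)) g where
  strictMonoOn_left := by
    intro x hx y hy hxy
    dsimp only
    split_ifs with h₁ h₂ h₂
    · exact h.strictMonoOn_left h₁ h₂ hxy
    · exact (h.left_lt x h₁).trans_le le_self_add
    · exact absurd (hxy.trans h₂) h₁
    · refine add_lt_add_right ?_ _
      rwa [← add_lt_add_iff_left a, Ordinal.add_sub_cancel_of_le (not_lt.1 h₁),
        Ordinal.add_sub_cancel_of_le (not_lt.1 h₂)]
  strictMonoOn_right := h.strictMonoOn_right
  left_lt x hx := by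
    split_ifs with h₁
    · exact (h.left_lt x h₁).trans_le le_self_add
    · refine add_lt_add_right ?_ _
      rwa [← add_lt_add_iff_left a, Ordinal.add_sub_cancel_of_le (not_lt.1 h₁)]
  right_lt x hx := (h.right_lt x hx).trans_le le_self_add
  ne x hx y hy := by
    split_ifs with h₁
    · exact h.ne x h₁ y hy
    · exact ((h.right_lt y hy).trans_le le_self_add).ne'
  surj z hz := by
    rcases lt_or_ge z c with hzc | hzc
    · rcases h.surj z hzc with ⟨x, hx, rfl⟩ | hy
      · exact Or.inl ⟨x, hx.trans_le le_self_add, if_pos hx⟩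
      · exact Or.inr hy
    · refine Or.inl ⟨a + (z - c), add_lt_add_right ?_ _, ?_⟩
      · rwa [← add_lt_add_iff_left c, Ordinal.add_sub_cancel_of_le hzc]
      · rw [if_neg (not_lt.2 le_self_add), Ordinal.add_sub_cancel,
          Ordinal.add_sub_cancel_of_le hzc]

/-- Of the last Cantor terms of `a` and `b`, peel off the one with the smaller exponent. By
`natAdd_add_add` it is also an ordinary last summand of `natAdd a b`, so it can be appended as a
final block to a merge obtained by induction. -/
theorem exists_isPairMerge_natAdd (a b : Ordinal.{u}) :
    ∃ f g, IsPairMerge a b (natAdd a b) f g := by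
  suffices H : ∀ c a b : Ordinal.{u}, natAdd a b = c → ∃ f g, IsPairMerge a b c f g from
    H _ a b rfl
  intro c
  induction c using WellFoundedLT.induction with
  | ind c IH =>
    intro a b hc
    rcases eq_or_ne a 0 with rfl | ha
    · obtain rfl : b = c := by simpa using hc
      exact ⟨id, id, ⟨fun x hx => by simp at hx, strictMonoOn_id, fun x hx => by simp at hx,
        fun x hx => hx, fun x hx => by simp at hx, fun z hz => Or.inr ⟨z, hz, rfl⟩⟩⟩
    rcases eq_or_ne b 0 with rfl | hb
    · obtain rfl : a = c := by simpa using hc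
      exact ⟨id, id, ⟨strictMonoOn_id, fun x hx => by simp at hx, fun x hx => hx,
        fun x hx => by simp at hx, fun x _ y hy => by simp at hy, fun z hz => Or.inl ⟨z, hz, rfl⟩⟩⟩
    have key : ∀ a b a' e : Ordinal.{u}, natAdd a b = c → a = a' + ω ^ e → ExponentsGE e a' →
        ExponentsGE e b → ∃ f g, IsPairMerge a b c f g := by
      rintro a b a' e hc rfl ha' hb'
      have hsum : natAdd (a' + ω ^ e) b = natAdd a' b + ω ^ e := by
        simpa using natAdd_add_add ha' (exponentsLE_opow e) hb' (exponentsLE_zero e)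
      obtain ⟨f, g, hfg⟩ := IH (natAdd a' b) (by
        rw [← hc, hsum]
        exact lt_add_of_pos_right _ (opow_pos _ omega0_pos)) a' b rfl
      rw [← hc, hsum]
      exact ⟨_, _, hfg.add_right _⟩
    obtain ⟨a', e, ha', hae, haa⟩ := exists_eq_add_opow ha
    obtain ⟨b', e', hb', hbe, hbb⟩ := exists_eq_add_opow hb
    rcases le_total e e' with h | h
    · exact key a b a' e hc ha' hae (hbb.mono h)
    · obtain ⟨f, g, hfg⟩ := key b a b' e' (natAdd_comm b a ▸ hc) hb' hbe (haa.mono h)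
      exact ⟨g, f, hfg.symm⟩

/-- The maps `m i`, for `i ∈ s`, merge the ordinals `a i` into the ordinal `c`. -/
structure IsMerge {I : Type*} (a : I → Ordinal.{u}) (s : Set I) (c : Ordinal.{u})
    (m : I → Ordinal.{u} → Ordinal.{u}) : Prop where
  strictMonoOn : ∀ i ∈ s, StrictMonoOn (m i) (Iio (a i))
  lt : ∀ i ∈ s, ∀ x < a i, m i x < c
  inj : ∀ i ∈ s, ∀ j ∈ s, ∀ x < a i, ∀ y < a j, m i x = m j y → i = j
  surj : ∀ z < c, ∃ i ∈ s, ∃ x < a i, m i x = z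

/-- The finite natural sums of a sequence of ordinals. -/
noncomputable def partialSum (a : ℕ → Ordinal.{u}) : ℕ → Ordinal.{u}
  | 0 => 0
  | n + 1 => natAdd (partialSum a n) (a n)

theorem partialSum_mono (a : ℕ → Ordinal.{u}) : Monotone (partialSum a) :=
  monotone_nat_of_le_succ fun _ => left_le_natAdd _ _

theorem partialSum_strictMono {a : ℕ → Ordinal.{u}} (ha : ∀ n, 0 < a n) :
    StrictMono (partialSum a) :=
  strictMono_nat_of_lt_succ fun n => by
    simpa [partialSum] using natAdd_lt_natAdd_left (ha n) (partialSum a n)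

theorem exists_isMerge_partialSum (a : ℕ → Ordinal.{u}) (n : ℕ) :
    ∃ m, IsMerge a (Iio n) (partialSum a n) m := by
  induction n with
  | zero =>
    exact ⟨fun _ => id, fun i hi => by simp at hi, fun i hi => by simp at hi,
      fun i hi => by simp at hi, fun z hz => by simp [partialSum] at hz⟩
  | succ n IH =>
    obtain ⟨m, hm⟩ := IH
    obtain ⟨f, g, h⟩ := exists_isPairMerge_natAdd (partialSum a n) (a n)
    have hcase : ∀ i ∈ Iio (n + 1), i < n ∨ i = n := fun i hi => by
      rw [mem_Iio] at hi
      omega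
    refine ⟨fun i x => if i < n then f (m i x) else g x, ?_, ?_, ?_, ?_⟩
    · intro i hi x hx y hy hxy
      dsimp only
      rcases hcase i hi with hi | rfl
      · rw [if_pos hi, if_pos hi]
        exact h.strictMonoOn_left (hm.lt i hi x hx) (hm.lt i hi y hy)
          (hm.strictMonoOn i hi hx hy hxy)
      · rw [if_neg (lt_irrefl _), if_neg (lt_irrefl _)]
        exact h.strictMonoOn_right hx hy hxy
    · intro i hi x hx
      rcases hcase i hi with hi | rfl
      · rw [if_pos hi]
        exact h.left_lt _ (hm.lt i hi x hx)
      · rw [if_neg (lt_irrefl _)]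
        exact h.right_lt _ hx
    · intro i hi j hj x hx y hy
      rcases hcase i hi with hi | rfl <;> rcases hcase j hj with hj | hj
      · rw [if_pos hi, if_pos hj]
        intro hxy
        exact hm.inj i hi j hj x hx y hy
          (h.strictMonoOn_left.injOn (hm.lt i hi x hx) (hm.lt j hj y hy) hxy)
      · subst hj
        rw [if_pos hi, if_neg (lt_irrefl _)]
        exact fun hxy => absurd hxy (h.ne _ (hm.lt i hi x hx) _ hy)
      · rw [if_neg (lt_irrefl _), if_pos hj]
        exact fun hxy => absurd hxy.symm (h.ne _ (hm.lt j hj y hy) _ hx)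
      · exact fun _ => hj.symm
    · intro z hz
      rcases h.surj z hz with ⟨w, hw, rfl⟩ | ⟨y, hy, rfl⟩
      · obtain ⟨i, hi, x, hx, rfl⟩ := hm.surj w hw
        exact ⟨i, Nat.lt_succ_of_lt hi, x, hx, if_pos hi⟩
      · exact ⟨n, Nat.lt_succ_self n, y, hy, if_neg (lt_irrefl _)⟩

/-! ### Sequences of length ω: a finite shuffle followed by consecutive blocks -/

/-- The partial (ordinary) sums `c + a n + a (n + 1) + ⋯ + a (n + k - 1)`. -/
noncomputable def tailSum (a : ℕ → Ordinal.{u}) (c : Ordinal.{u}) (n : ℕ) : ℕ → Ordinal.{u}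
  | 0 => c
  | k + 1 => tailSum a c n k + a (n + k)

theorem tailSum_mono (a : ℕ → Ordinal.{u}) (c : Ordinal.{u}) (n : ℕ) :
    Monotone (tailSum a c n) :=
  monotone_nat_of_le_succ fun _ => le_self_add

/-- The ordinals of index at least `n` become consecutive intervals after `c`. A point below the
`k`-th tail sum precedes all blocks from index `n + k` on, whence the finiteness. -/
theorem IsMerge.exists_tail {a : ℕ → Ordinal.{u}} {c : Ordinal.{u}} {n : ℕ}
    {m : ℕ → Ordinal.{u} → Ordinal.{u}} (h : IsMerge a (Iio n) c m) :
    ∃ m', IsMerge a univ (⨆ k, tailSum a c n k) m' ∧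
      ∀ z < ⨆ k, tailSum a c n k, {i | ∃ x < a i, m' i x ≤ z}.Finite := by
  have hlt : ∀ i x, n ≤ i → x < a i →
      tailSum a c n (i - n) + x < tailSum a c n (i - n + 1) := fun i x hi hx => by
    rw [tailSum, Nat.add_sub_cancel' hi]
    exact add_lt_add_right hx _
  have hbdd : BddAbove (range (tailSum a c n)) := bddAbove_of_small
  have hle : ∀ k, tailSum a c n k ≤ ⨆ k, tailSum a c n k := fun k => le_ciSup hbdd k
  have hc : ∀ k, c ≤ tailSum a c n k := fun k => tailSum_mono a c n (Nat.zero_le k)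
  have hord : ∀ i j x, n ≤ i → i < j → x < a i →
      tailSum a c n (i - n) + x < tailSum a c n (j - n) := fun i j x hi hij hx =>
    (hlt i x hi hx).trans_le (tailSum_mono a c n (by omega))
  refine ⟨fun i x => if i < n then m i x else tailSum a c n (i - n) + x, ⟨?_, ?_, ?_, ?_⟩, ?_⟩
  · intro i _ x hx y hy hxy
    dsimp only
    split_ifs with hi
    · exact h.strictMonoOn i hi hx hy hxy
    · exact add_lt_add_right hxy _
  · intro i _ x hx
    split_ifs with hi
    · exact (h.lt i hi x hx).trans_le (hle 0)
    · exact (hlt i x (not_lt.1 hi) hx).trans_le (hle _)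
  · intro i _ j _ x hx y hy
    split_ifs with hi hj hj
    · exact h.inj i hi j hj x hx y hy
    · exact fun hxy => absurd hxy
        (((h.lt i hi x hx).trans_le (hc _)).trans_le le_self_add).ne
    · exact fun hxy => absurd hxy.symm
        (((h.lt j hj y hy).trans_le (hc _)).trans_le le_self_add).ne
    · intro hxy
      rcases lt_trichotomy i j with hij | hij | hij
      · exact absurd hxy ((hord i j x (not_lt.1 hi) hij hx).trans_le le_self_add).ne
      · exact hij
      · exact absurd hxy.symm ((hord j i y (not_lt.1 hj) hij hy).trans_le le_self_add).ne
  · intro z hz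
    obtain ⟨k, hk⟩ := (lt_ciSup_iff hbdd).1 hz
    clear hz
    induction k with
    | zero =>
      obtain ⟨i, hi, x, hx, rfl⟩ := h.surj z hk
      exact ⟨i, mem_univ _, x, hx, if_pos hi⟩
    | succ k IH =>
      rcases lt_or_ge z (tailSum a c n k) with hzk | hzk
      · exact IH hzk
      · refine ⟨n + k, mem_univ _, z - tailSum a c n k, ?_, ?_⟩
        · rwa [← add_lt_add_iff_left (tailSum a c n k), Ordinal.add_sub_cancel_of_le hzk]
        · rw [if_neg (by omega), Nat.add_sub_cancel_left, Ordinal.add_sub_cancel_of_le hzk]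
  · intro z hz
    obtain ⟨k, hk⟩ := (lt_ciSup_iff hbdd).1 hz
    refine (finite_lt_nat (n + k)).subset ?_
    rintro i ⟨x, hx, hxz⟩
    by_contra hi
    have hi' : n + k ≤ i := not_lt.1 hi
    dsimp only at hxz
    rw [if_neg (by omega)] at hxz
    have := tailSum_mono a c n (show k ≤ i - n by omega)
    exact ((hk.trans_le this).trans_le le_self_add).not_ge hxz

/-- If the tail sums stayed below S = ρ + ω^ξ, their excess R over ρ would be less than ω^ξ. With η
the leading exponent of R, almost all terms would lie below ω^η, so the later natural sums could
grow by at most ω^η and would remain bounded away from S. Positivity ensures that no partial sum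
attains S. -/
theorem exists_partialSum_le_iSup_tailSum {a : ℕ → Ordinal.{u}} (ha : ∀ n, 0 < a n) :
    ∃ n, ⨆ k, partialSum a k ≤ ⨆ k, tailSum a (partialSum a n) n k := by
  have hbdd : ∀ f : ℕ → Ordinal.{u}, BddAbove (range f) := fun f => bddAbove_of_small
  set S := ⨆ k, partialSum a k with hS
  have hlt : ∀ k, partialSum a k < S := fun k =>
    (partialSum_strictMono ha (Nat.lt_succ_self k)).trans_le (le_ciSup (hbdd _) (k + 1))
  obtain ⟨ρ, ξ, hSρ, hρ, -⟩ := exists_eq_add_opow (a := S) (hlt 0).ne_bot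
  obtain ⟨n, hn⟩ := (lt_ciSup_iff (hbdd _)).1
    (show ρ < S by rw [hSρ]; exact lt_add_of_pos_right _ (opow_pos _ omega0_pos))
  refine ⟨n, not_lt.1 fun hR => ?_⟩
  set t := tailSum a (partialSum a n) n with ht
  have htle : ∀ k, t k ≤ ⨆ k, t k := fun k => le_ciSup (hbdd _) k
  have hρR : ρ ≤ ⨆ k, t k := hn.le.trans (htle 0)
  set R := (⨆ k, t k) - ρ with hRdef
  have hR' : ρ + R = ⨆ k, t k := Ordinal.add_sub_cancel_of_le hρR
  have hRlt : R < ω ^ ξ := by rwa [← add_lt_add_iff_left ρ, hR', ← hSρ]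
  have hR0 : R ≠ 0 := by
    intro h0
    rw [h0, add_zero] at hR'
    exact (hn.trans_le (htle 0)).ne hR'
  set η := log ω R with hη
  have hηξ : η < ξ := (lt_opow_iff_log_lt one_lt_omega0 hR0).1 hRlt
  -- Infinitely many terms at least `ω ^ η` would make the tail exceed `ρ + ω ^ η * p` for every
  -- `p`, whereas the quotient of `R` by `ω ^ η` is finite.
  obtain ⟨M, hnM, hM⟩ : ∃ M, n ≤ M ∧ ∀ k, M ≤ k → a k < ω ^ η := by
    by_contra! hcon
    have hbig : ∀ p : ℕ, ∃ j, ρ + ω ^ η * p ≤ t j := by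
      intro p
      induction p with
      | zero => exact ⟨0, by simpa [ht, tailSum] using hn.le⟩
      | succ p IH =>
        obtain ⟨j, hj⟩ := IH
        obtain ⟨k, hk, hak⟩ := hcon (n + j) (Nat.le_add_right _ _)
        refine ⟨k - n + 1, ?_⟩
        have h1 : t (k - n + 1) = t (k - n) + a k := by
          rw [ht, tailSum, Nat.add_sub_cancel' (by omega)]
        rw [h1, Nat.cast_succ, mul_add_one, ← add_assoc]
        exact add_le_add (hj.trans (tailSum_mono _ _ _ (by omega))) hak
    have hdiv := div_opow_log_lt R one_lt_omega0
    obtain ⟨p, hp⟩ := lt_omega0.1 hdiv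
    obtain ⟨j, hj⟩ := hbig (p + 1)
    have h2 : ω ^ η * ((p + 1 : ℕ) : Ordinal) ≤ R := by
      rw [← add_le_add_iff_left ρ, hR']
      exact hj.trans (htle j)
    have h3 : ((p + 1 : ℕ) : Ordinal) ≤ R / ω ^ η :=
      (Ordinal.mul_le_iff_le_div (opow_pos _ omega0_pos).ne').1 h2
    rw [hη, hp] at h3
    exact absurd (Nat.cast_le.1 h3) (by omega)
  -- Ordinals below `ω ^ η` are closed under natural sums, so all terms after `M` together
  -- contribute less than `ω ^ η` at each finite stage.
  have hE : ∀ k, ∃ E < ω ^ η, partialSum a (M + k) = natAdd (partialSum a M) E := by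
    intro k
    induction k with
    | zero => exact ⟨0, opow_pos _ omega0_pos, by simp⟩
    | succ k IH =>
      obtain ⟨E, hE, hEq⟩ := IH
      refine ⟨natAdd E (a (M + k)), natAdd_lt_opow hE (hM _ (Nat.le_add_right _ _)), ?_⟩
      rw [← add_assoc, partialSum, hEq, natAdd_assoc]
  have hSle : S ≤ natAdd (partialSum a M) (ω ^ η) := by
    refine ciSup_le fun k => (partialSum_mono a (Nat.le_add_left k M)).trans ?_
    obtain ⟨E, hE, hEq⟩ := hE k
    rw [hEq]
    exact (natAdd_lt_natAdd_left hE _).le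
  have hρM : ρ ≤ partialSum a M := hn.le.trans (partialSum_mono a hnM)
  set τ := partialSum a M - ρ
  have hτ : ρ + τ = partialSum a M := Ordinal.add_sub_cancel_of_le hρM
  have hτlt : τ < ω ^ ξ := by
    rw [← add_lt_add_iff_left ρ, hτ, ← hSρ]
    exact hlt M
  have hηlt : ω ^ η < ω ^ ξ := (opow_lt_opow_iff_right one_lt_omega0).2 hηξ
  -- Cut at `ξ`: `ρ` has only exponents at least `ξ`, while `τ` and `ω ^ η` lie below `ω ^ ξ`.
  have hB : natAdd (partialSum a M) (ω ^ η) = ρ + natAdd τ (ω ^ η) := by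
    have := natAdd_add_add hρ (exponentsLE_of_lt hτlt) (exponentsGE_zero ξ)
      (exponentsLE_of_lt hηlt)
    rwa [hτ, zero_add, natAdd_zero] at this
  rw [hB, hSρ] at hSle
  exact hSle.not_gt (add_lt_add_right (natAdd_lt_opow hτlt hηlt) _)

theorem exists_isMerge_iSup_partialSum {a : ℕ → Ordinal.{u}} (ha : ∀ n, 0 < a n) :
    ∃ c m, ⨆ k, partialSum a k ≤ c ∧ IsMerge a univ c m ∧
      ∀ z < c, {i | ∃ x < a i, m i x ≤ z}.Finite := by
  obtain ⟨n, hn⟩ := exists_partialSum_le_iSup_tailSum ha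
  obtain ⟨m, hm⟩ := exists_isMerge_partialSum a n
  obtain ⟨m', hm', hfin⟩ := hm.exists_tail
  exact ⟨_, m', hn, hm', hfin⟩

theorem iterNatSum_natCast (a : Ordinal.{u} → Ordinal.{u}) (n : ℕ) :
    iterNatSum a n = partialSum (fun k => a k) n := by
  induction n with
  | zero => simpa [partialSum] using iterNatSum_zero a
  | succ n IH => rw [Nat.cast_succ, iterNatSum_add_one, IH, partialSum]

theorem iterNatSum_omega0 (a : Ordinal.{u} → Ordinal.{u}) :
    iterNatSum a ω = ⨆ n, partialSum (fun k => a k) n := by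
  have hbdd : ∀ {ι : Type u} (f : ι → Ordinal.{u}), BddAbove (range f) :=
    fun f => bddAbove_of_small
  rw [iterNatSum_limit a isSuccLimit_omega0]
  apply le_antisymm
  · refine ciSup_le' ?_
    rintro ⟨γ, hγ⟩
    obtain ⟨n, rfl⟩ := lt_omega0.1 hγ
    dsimp only
    rw [iterNatSum_natCast]
    exact le_ciSup (f := fun n => partialSum (fun k => a k) n) (bddAbove_of_small) n
  · refine ciSup_le' fun n => ?_
    rw [← iterNatSum_natCast]
    exact le_ciSup (f := fun γ : Iio (ω : Ordinal.{u}) => iterNatSum a γ.1)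
      (bddAbove_of_small) ⟨n, natCast_lt_omega0 n⟩

theorem IsMerge.comp {I J : Type*} {a : I → Ordinal.{u}} {b : J → Ordinal.{u}} {s : Set J}
    {c : Ordinal.{u}} {m : J → Ordinal.{u} → Ordinal.{u}} (h : IsMerge b s c m) (e : I → J)
    (he : BijOn e univ s) (hab : ∀ i, b (e i) = a i) : IsMerge a univ c (fun i => m (e i)) where
  strictMonoOn i _ := hab i ▸ h.strictMonoOn (e i) (he.mapsTo (mem_univ i))
  lt i _ x hx := h.lt (e i) (he.mapsTo (mem_univ i)) x (by rwa [hab])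
  inj i _ j _ x hx y hy hxy := he.injOn (mem_univ i) (mem_univ j)
    (h.inj (e i) (he.mapsTo (mem_univ i)) (e j) (he.mapsTo (mem_univ j)) x (by rwa [hab]) y
      (by rwa [hab]) hxy)
  surj z hz := by
    obtain ⟨j, hj, x, hx, rfl⟩ := h.surj z hz
    obtain ⟨i, hi, rfl⟩ := he.surjOn hj
    exact ⟨i, hi, x, by rwa [← hab], rfl⟩

theorem natSum_le {I : Type u} (α : I → Ordinal.{u}) {ζ : Ordinal.{u}} (f : Iio ζ ≃ I) :
    natSum α ≤ iterNatSum (rearrange α f) ζ :=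
  csInf_le' ⟨ζ, f, rfl⟩

theorem rearrange_symm_apply {I : Type u} (α : I → Ordinal.{u}) {ζ : Ordinal.{u}}
    (f : Iio ζ ≃ I) (i : I) : rearrange α f (f.symm i) = α i := by
  have h : (f.symm i : Ordinal.{u}) < ζ := (f.symm i).2
  rw [rearrange, dif_pos h]
  exact congrArg α (f.apply_symm_apply i)

/-- Any enumeration of length at most ω serves: `natSum` is a minimum, and only a lower bound on `c`
is wanted. -/
theorem exists_isMerge_natSum {I : Type u} [Countable I] (α : I → Ordinal.{u})
    (hα : ∀ i, 0 < α i) :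
    ∃ c m, natSum α ≤ c ∧ IsMerge α univ c m ∧ ∀ z < c, {i | ∃ x < α i, m i x ≤ z}.Finite := by
  rcases finite_or_infinite I with hI | hI
  · obtain ⟨n, ⟨e⟩⟩ := Finite.exists_equiv_fin I
    let g : Fin n ≃ Iio (n : Ordinal.{u}) := Equiv.ofBijective
      (fun k => ⟨(k : ℕ), mem_Iio.2 (Nat.cast_lt.2 k.2)⟩)
      ⟨fun k l h => Fin.ext (Nat.cast_injective (R := Ordinal.{u}) (congrArg Subtype.val h)),
        fun ⟨x, hx⟩ => by
          obtain ⟨k, rfl⟩ := lt_omega0.1 (lt_trans hx (natCast_lt_omega0 n))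
          exact ⟨⟨k, Nat.cast_lt.1 (mem_Iio.1 hx)⟩, rfl⟩⟩
    let f : Iio (n : Ordinal.{u}) ≃ I := g.symm.trans e.symm
    obtain ⟨m, hm⟩ := exists_isMerge_partialSum (fun k : ℕ => rearrange α f k) n
    refine ⟨_, fun i => m (e i), (natSum_le α f).trans (iterNatSum_natCast _ n).le,
      hm.comp (fun i => (e i : ℕ)) ⟨fun i _ => (e i).2, fun i _ j _ h => e.injective (Fin.ext h),
        fun k hk => ⟨e.symm ⟨k, hk⟩, mem_univ _, by simp⟩⟩ fun i => ?_, fun z _ => toFinite _⟩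
    exact rearrange_symm_apply α f i
  · obtain ⟨e⟩ := nonempty_equiv_of_countable (α := I) (β := ℕ)
    let g : ℕ ≃ Iio (ω : Ordinal.{u}) := Equiv.ofBijective
      (fun k => ⟨(k : Ordinal), natCast_lt_omega0 k⟩)
      ⟨fun k l h => Nat.cast_injective (R := Ordinal.{u}) (congrArg Subtype.val h),
        fun ⟨x, hx⟩ => by
          obtain ⟨k, rfl⟩ := lt_omega0.1 hx
          exact ⟨k, rfl⟩⟩
    let f : Iio (ω : Ordinal.{u}) ≃ I := g.symm.trans e.symm
    have hval : ∀ i, rearrange α f (e i : ℕ) = α i := rearrange_symm_apply α f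
    obtain ⟨c, m, hc, hm, hfin⟩ := exists_isMerge_iSup_partialSum
      (a := fun k : ℕ => rearrange α f k) fun k => by
        obtain ⟨i, rfl⟩ := e.surjective k
        rw [hval]
        exact hα i
    refine ⟨c, fun i => m (e i), ((natSum_le α f).trans (iterNatSum_omega0 _).le).trans hc,
      hm.comp e (bijOn_univ.2 e.bijective) hval, fun z hz => ?_⟩
    refine ((hfin z hz).preimage e.injective.injOn).subset ?_
    rintro i ⟨x, hx, hxz⟩
    exact ⟨x, by rwa [hval], hxz⟩

theorem iterNatSum_mono {a b : Ordinal.{u} → Ordinal.{u}} (h : ∀ γ, a γ ≤ b γ)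
    (δ : Ordinal.{u}) : iterNatSum a δ ≤ iterNatSum b δ := by
  induction δ using Ordinal.limitRecOn with
  | zero => rw [iterNatSum_zero, iterNatSum_zero]
  | add_one δ IH =>
    rw [iterNatSum_add_one, iterNatSum_add_one]
    exact natAdd_le_natAdd IH (h δ)
  | limit δ hδ IH =>
    rw [iterNatSum_limit a hδ, iterNatSum_limit b hδ]
    exact ciSup_mono (bddAbove_of_small) fun γ => IH γ.1 γ.2

theorem natSum_mono {I : Type u} {α β : I → Ordinal.{u}} (h : ∀ i, α i ≤ β i) :
    natSum α ≤ natSum β := by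
  obtain ⟨ζ, f, hf⟩ := csInf_mem (rearrangedSums_nonempty β)
  rw [natSum.eq_1 β, hf]
  refine (natSum_le α f).trans (iterNatSum_mono (fun γ => ?_) ζ)
  unfold rearrange
  split_ifs
  exacts [h _, le_rfl]

end Merge

/-! ### Order types of subsets of a well-order -/

section OrderType

variable {T : Type u} (r : T → T → Prop) [IsWellOrder T r]

/-- The order type of the set `B` under the well-order `r`. -/
noncomputable def otp (B : Set T) : Ordinal.{u} := Ordinal.type (Subrel r (· ∈ B))

variable {r}

theorem otp_le {B : Set T} {c : Ordinal.{u}} (g : B → Ordinal.{u})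
    (hg : ∀ x y : B, r x y → g x < g y) (hc : ∀ x, g x < c) : otp r B ≤ c := by
  have h : ∀ x : B, typein (Subrel r (· ∈ B)) x ≤ g x := by
    intro x
    induction x using (IsWellFounded.wf (r := Subrel r (· ∈ B))).induction with
    | _ x IH =>
      refine le_of_forall_lt fun o ho => ?_
      obtain ⟨y, rfl⟩ := typein_surj _ (ho.trans (typein_lt_type _ x))
      have hyx : Subrel r (· ∈ B) y x := (typein_lt_typein _).1 ho
      exact (IH y hyx).trans_lt (hg y x hyx)
  refine le_of_forall_lt fun o ho => ?_
  obtain ⟨y, rfl⟩ := typein_surj _ ho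
  exact (h y).trans_lt (hc y)

theorem otp_mono {B C : Set T} (h : B ⊆ C) : otp r B ≤ otp r C :=
  otp_le (fun x => typein (Subrel r (· ∈ C)) ⟨x, h x.2⟩)
    (fun _ _ hxy => (typein_lt_typein (Subrel r (· ∈ C))).2 hxy) fun _ => typein_lt_type _ _

theorem otp_inter_lt {B : Set T} {v : T} (hv : v ∈ B) : otp r (B ∩ {x | r x v}) < otp r B :=
  (otp_le (fun x => typein (Subrel r (· ∈ B)) ⟨x, x.2.1⟩)
    (fun _ _ hxy => (typein_lt_typein (Subrel r (· ∈ B))).2 hxy)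
    fun x => (typein_lt_typein (Subrel r (· ∈ B)) (b := ⟨v, hv⟩)).2 x.2.2).trans_lt
    (typein_lt_type (Subrel r (· ∈ B)) ⟨v, hv⟩)

theorem otp_inter_lt_otp_inter {B : Set T} {v w : T} (hv : v ∈ B) (h : r v w) :
    otp r (B ∩ {x | r x v}) < otp r (B ∩ {x | r x w}) := by
  have : B ∩ {x | r x v} ⊆ (B ∩ {x | r x w}) ∩ {x | r x v} :=
    fun x hx => ⟨⟨hx.1, _root_.trans hx.2 h⟩, hx.2⟩
  exact (otp_mono this).trans_lt (otp_inter_lt ⟨hv, h⟩)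

theorem otp_inter_le_otp_inter (B : Set T) {v w : T} (h : r v w) :
    otp r (B ∩ {x | r x v}) ≤ otp r (B ∩ {x | r x w}) :=
  otp_mono fun _ hx => ⟨hx.1, _root_.trans hx.2 h⟩

theorem natAdd_lt_natAdd_of_lt_of_le {a b c d : Ordinal.{u}} (h : a < b) (h' : c ≤ d) :
    natAdd a c < natAdd b d :=
  (natAdd_lt_natAdd_right h c).trans_le (natAdd_le_natAdd le_rfl h')

theorem natAdd_lt_natAdd_of_le_of_lt {a b c d : Ordinal.{u}} (h : a ≤ b) (h' : c < d) :
    natAdd a c < natAdd b d :=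
  (natAdd_le_natAdd h le_rfl).trans_lt (natAdd_lt_natAdd_left h' b)

/-- Send `x` to the natural sum of the types of the parts of `B` and `C` before `x`. Passing from
`x` to a later point strictly enlarges the part of whichever set contains `x`, and `natAdd` is
strictly monotone in both arguments. -/
theorem otp_union_le (B C : Set T) : otp r (B ∪ C) ≤ natAdd (otp r B) (otp r C) := by
  refine otp_le (fun x => natAdd (otp r (B ∩ {y | r y x})) (otp r (C ∩ {y | r y x})))
    (fun x y hxy => ?_) fun x => ?_
  · rcases x.2 with h | h
    · exact natAdd_lt_natAdd_of_lt_of_le (otp_inter_lt_otp_inter h hxy)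
        (otp_inter_le_otp_inter C hxy)
    · exact natAdd_lt_natAdd_of_le_of_lt (otp_inter_le_otp_inter B hxy)
        (otp_inter_lt_otp_inter h hxy)
  · rcases x.2 with h | h
    · exact natAdd_lt_natAdd_of_lt_of_le (otp_inter_lt h) (otp_mono inter_subset_left)
    · exact natAdd_lt_natAdd_of_le_of_lt (otp_mono inter_subset_left) (otp_inter_lt h)

theorem otp_le_of_forall_initial {B : Set T} {c : Ordinal.{u}}
    (h : ∀ v ∈ B, otp r {x ∈ B | x = v ∨ r x v} ≤ c) : otp r B ≤ c := by
  refine otp_le (fun x => otp r (B ∩ {y | r y x}))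
    (fun x y hxy => otp_inter_lt_otp_inter x.2 hxy) fun x => ?_
  refine lt_of_lt_of_le ?_ (h x x.2)
  have : B ∩ {y | r y x} ⊆ {y ∈ B | y = x ∨ r y x} ∩ {y | r y x} :=
    fun y hy => ⟨⟨hy.1, Or.inr hy.2⟩, hy.2⟩
  exact (otp_mono this).trans_lt (otp_inter_lt ⟨x.2, Or.inl rfl⟩)

theorem otp_empty : otp r (∅ : Set T) = 0 :=
  le_antisymm (otp_le (fun _ => 0) (fun x => x.2.elim) fun x => x.2.elim) (zero_le)

/-- Induction along an optimal rearrangement. At a limit stage the finitely many indices in `s` are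
already bounded by an earlier stage, so no limit of unions has to be estimated. -/
theorem otp_biUnion_le_natSum {I : Type u} {α : I → Ordinal.{u}} {A : I → Set T}
    (hA : ∀ i, otp r (A i) ≤ α i) {s : Set I} (hs : s.Finite) :
    otp r (⋃ i ∈ s, A i) ≤ natSum α := by
  obtain ⟨ζ, f, hf⟩ := csInf_mem (rearrangedSums_nonempty α)
  rw [natSum, hf]
  suffices H : ∀ δ ≤ ζ, ∀ s : Set I, s.Finite → (∀ i ∈ s, (f.symm i : Ordinal.{u}) < δ) →
      otp r (⋃ i ∈ s, A i) ≤ iterNatSum (rearrange α f) δ from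
    H ζ le_rfl s hs fun i _ => (f.symm i).2
  intro δ
  induction δ using Ordinal.limitRecOn with
  | zero =>
    intro _ s _ h
    have : s = ∅ := eq_empty_of_forall_notMem fun i hi => by simpa using h i hi
    simp [this, otp_empty]
  | add_one δ IH =>
    intro hδ s hs h
    have hδ' : δ < ζ := (lt_add_one δ).trans_le hδ
    have hsub : ⋃ i ∈ s, A i ⊆ (⋃ i ∈ s \ {f ⟨δ, hδ'⟩}, A i) ∪ A (f ⟨δ, hδ'⟩) := by
      intro x hx
      simp only [mem_iUnion, exists_prop] at hx
      obtain ⟨i, hi, hx⟩ := hx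
      by_cases hif : i = f ⟨δ, hδ'⟩
      · exact Or.inr (hif ▸ hx)
      · exact Or.inl (mem_biUnion (⟨hi, hif⟩ : i ∈ s \ {f ⟨δ, hδ'⟩}) hx)
    refine (otp_mono hsub).trans ((otp_union_le _ _).trans ?_)
    rw [iterNatSum_add_one]
    refine natAdd_le_natAdd (IH hδ'.le _ (hs.subset sdiff_subset) fun i hi => ?_) ?_
    · refine lt_of_le_of_ne (Order.lt_add_one_iff.1 (h i hi.1)) fun heq => hi.2 ?_
      have : f.symm i = ⟨δ, hδ'⟩ := Subtype.ext heq
      rw [mem_singleton_iff, ← this, Equiv.apply_symm_apply]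
    · rw [rearrange, dif_pos hδ']
      exact hA _
  | limit δ hδ IH =>
    intro hδζ s hs h
    obtain ⟨γ, hγ, hsγ⟩ : ∃ γ < δ, ∀ i ∈ s, (f.symm i : Ordinal.{u}) < γ := by
      have : ((fun i => (f.symm i : Ordinal.{u})) '' s).Finite := hs.image _
      rcases s.eq_empty_or_nonempty with rfl | hne
      · exact ⟨0, hδ.bot_lt, by simp⟩
      · obtain ⟨i, hi, hmax⟩ := exists_max_image s (fun i => (f.symm i : Ordinal.{u})) hs hne
        exact ⟨f.symm i + 1, hδ.add_one_lt (h i hi),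
          fun j hj => Order.lt_add_one_iff.2 (hmax j hj)⟩
    rw [iterNatSum_limit _ hδ]
    exact (IH γ hγ (hγ.le.trans hδζ) s hs hsγ).trans
      (le_ciSup (f := fun γ : Iio δ => iterNatSum (rearrange α f) γ.1) bddAbove_of_small ⟨γ, hγ⟩)

end OrderType

/-! ### Reversed trees and the upper bound -/

section Tree

variable {T : Type u} [PartialOrder T]

theorem IsReversedTree.le_total_of_le (hT : IsReversedTree T) {w u v : T} (hu : w ≤ u)
    (hv : w ≤ v) : u ≤ v ∨ v ≤ u := by
  rcases hu.eq_or_lt with rfl | hu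
  · exact Or.inl hv
  rcases hv.eq_or_lt with rfl | hv
  · exact Or.inr hu.le
  exact (hT.chain_successors w).total hu hv

theorem IsReversedTree.exists_le_covBy (hT : IsReversedTree T) {w t : T} (h : w < t) :
    ∃ u, w ≤ u ∧ u ⋖ t := by
  have hfin : (Ico w t).Finite :=
    ((hT.finite_successors w).insert w).subset fun x hx => hx.1.eq_or_lt.imp Eq.symm id
  obtain ⟨u, hwu, hu⟩ := hfin.exists_le_maximal (⟨le_rfl, h⟩ : w ∈ Ico w t)
  refine ⟨u, hwu, hu.prop.2, fun x hux hxt => ?_⟩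
  exact hux.not_ge (hu.le_of_ge ⟨hwu.trans hux.le, hxt⟩ hux.le)

theorem IsReversedTree.exists_le_isMax (hT : IsReversedTree T) (w : T) :
    ∃ u, w ≤ u ∧ IsMax u := by
  have hfin : (Ici w).Finite :=
    ((hT.finite_successors w).insert w).subset fun x hx => hx.eq_or_lt.imp Eq.symm id
  obtain ⟨u, hwu, hu⟩ := hfin.exists_le_maximal (show w ∈ Ici w from le_rfl)
  exact ⟨u, hwu, fun x hux => hu.le_of_ge (hwu.trans hux) hux⟩

theorem IsReversedTree.eq_of_covBy (hT : IsReversedTree T) {w u v t : T} (hu : u ⋖ t)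
    (hv : v ⋖ t) (hwu : w ≤ u) (hwv : w ≤ v) : u = v := by
  rcases hT.le_total_of_le hwu hwv with h | h
  · exact h.eq_of_not_lt fun h' => hu.2 h' hv.lt
  · exact (h.eq_of_not_lt fun h' => hv.2 h' hu.lt).symm

theorem IsReversedTree.eq_of_isMax (hT : IsReversedTree T) {w u v : T} (hu : IsMax u)
    (hv : IsMax v) (hwu : w ≤ u) (hwv : w ≤ v) : u = v := by
  rcases hT.le_total_of_le hwu hwv with h | h
  · exact hu.eq_of_le h
  · exact (hv.eq_of_le h).symm

theorem IsReversedTree.iUnion_Iic_covBy (hT : IsReversedTree T) (t : T) :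
    ⋃ u : {u : T // u ⋖ t}, Iic u.1 = Iio t := by
  ext w
  simp only [mem_iUnion, mem_Iic, mem_Iio, Subtype.exists, exists_prop]
  constructor
  · rintro ⟨u, hu, hw⟩
    exact hw.trans_lt hu.lt
  · intro h
    obtain ⟨u, hwu, hu⟩ := hT.exists_le_covBy h
    exact ⟨u, hu, hwu⟩

theorem IsReversedTree.iUnion_Iic_isMax (hT : IsReversedTree T) :
    ⋃ u : {u : T // IsMax u}, Iic u.1 = Set.univ := by
  refine eq_univ_of_forall fun w => ?_
  obtain ⟨u, hwu, hu⟩ := hT.exists_le_isMax w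
  exact mem_iUnion.2 ⟨⟨u, hu⟩, hwu⟩

variable {r : T → T → Prop} [IsWellOrder T r]

/-- The order type of a forest under a downward-finite well-order is at most the natural sum of
the sizes of its components. -/
theorem otp_iUnion_Iic_le_natSum
    (hr : IsDownwardFiniteExtension fun x y => x = y ∨ r x y) {I : Type u} {ρ : I → T}
    (hρ : ∀ u w, w ≤ u → w ∈ ⋃ i, Iic (ρ i) →
      u ∈ ⋃ i, Iic (ρ i) ∨ ∀ v ∈ ⋃ i, Iic (ρ i), v ≤ u)
    {α : I → Ordinal.{u}} (hα : ∀ i, otp r (Iic (ρ i)) ≤ α i) :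
    otp r (⋃ i, Iic (ρ i)) ≤ natSum α := by
  refine otp_le_of_forall_initial fun v hv => ?_
  obtain ⟨F, hF, hvF⟩ := hr.downward_finite v
  obtain ⟨i₀, -⟩ := mem_iUnion.1 hv
  -- `i₀` is only a default index for elements outside the forest.
  have hidx : ∀ u, ∃ i, u ∈ ⋃ i, Iic (ρ i) → u ≤ ρ i := fun u => by
    by_cases hu : u ∈ ⋃ i, Iic (ρ i)
    · obtain ⟨i, hi⟩ := mem_iUnion.1 hu
      exact ⟨i, fun _ => hi⟩
    · exact ⟨i₀, fun h => absurd h hu⟩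
  choose idx hidx using hidx
  refine (otp_mono ?_).trans
    (otp_biUnion_le_natSum hα ((F.finite_toSet.insert v).image idx))
  rintro x ⟨hx, hxv⟩
  rcases hvF hxv with h | h
  · exact mem_biUnion (mem_image_of_mem _ (mem_insert _ _)) (h.trans (hidx v hv))
  · simp only [mem_iUnion, exists_prop] at h
    obtain ⟨u, hu, hxu⟩ := h
    refine mem_biUnion (mem_image_of_mem _ (mem_insert_of_mem _ hu)) (le_trans hxu (hidx u ?_))
    -- An element `u` above the whole forest would be above `v`, against incomparability; so `u`
    -- lies in the forest and its component contains `x`.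
    exact (hρ u x hxu hx).resolve_right fun h => (hF u hu).2 (h v hv)

theorem otp_Iic_le_nodeSize [WellFoundedLT T] (hT : IsReversedTree T)
    (hr : IsDownwardFiniteExtension fun x y => x = y ∨ r x y) (t : T) :
    otp r (Iic t) ≤ nodeSize t := by
  induction t using WellFoundedLT.induction with
  | ind t IH =>
    have hIio : otp r (Iio t) ≤ natSum fun u : {u : T // u ⋖ t} => nodeSize u.1 := by
      rw [← hT.iUnion_Iic_covBy]
      refine otp_iUnion_Iic_le_natSum hr ?_ fun u => IH u.1 u.2.lt
      rw [hT.iUnion_Iic_covBy]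
      intro u w hwu hwt
      rcases hT.le_total_of_le hwu (le_of_lt hwt) with h | h
      · rcases h.eq_or_lt with rfl | h
        exacts [Or.inr fun v hv => le_of_lt hv, Or.inl h]
      · exact Or.inr fun v hv => (le_of_lt hv).trans h
    rw [nodeSize]
    refine otp_le (fun x => otp r (Iic t ∩ {y | r y x}))
      (fun x y hxy => otp_inter_lt_otp_inter x.2 hxy) fun x => ?_
    -- `t` is the `r`-last element of its down-set, so whatever precedes `x` there lies strictly
    -- below `t`.
    refine Order.lt_add_one_iff.2 (le_trans (otp_mono ?_) hIio)
    rintro y ⟨hyt, hyx⟩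
    refine lt_of_le_of_ne hyt ?_
    rintro rfl
    rcases hr.extends_le x y x.2 with h | h
    · exact irrefl (r := r) y (by rwa [mem_ofPred_eq, h] at hyx)
    · exact irrefl (r := r) y (_root_.trans hyx.out h)

theorem type_le_size [WellFoundedLT T] (hT : IsReversedTree T)
    (hr : IsDownwardFiniteExtension fun x y => x = y ∨ r x y) : Ordinal.type r ≤ size T := by
  have h1 : Ordinal.type r ≤ otp r (Set.univ : Set T) :=
    (RelEmbedding.ordinal_type_le (s := Subrel r (· ∈ (Set.univ : Set T)))
      ⟨⟨fun x => ⟨x, mem_univ x⟩, fun _ _ h => congrArg Subtype.val h⟩, Iff.rfl⟩)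
  refine h1.trans ?_
  rw [← hT.iUnion_Iic_isMax]
  exact otp_iUnion_Iic_le_natSum hr
    (fun u _ _ _ => Or.inl (hT.iUnion_Iic_isMax ▸ mem_univ u)) fun u => otp_Iic_le_nodeSize hT hr u

end Tree

/-! ### Building an extension of large order type -/

section Realization

variable {T : Type u} [PartialOrder T]

/-- The map `φ` arranges the set `A` in order type `c`, by a downward-finite extension of the
order of `A`. -/
structure IsRealization (A : Set T) (c : Ordinal.{u}) (φ : T → Ordinal.{u}) : Prop where
  bijOn : BijOn φ A (Iio c)
  monotoneOn : MonotoneOn φ A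
  downward_finite : ∀ v ∈ A, ∃ F : Finset T, (∀ u ∈ F, u ∈ A ∧ ¬ u ≤ v ∧ ¬ v ≤ u) ∧
    ∀ w ∈ A, φ w ≤ φ v → w ≤ v ∨ ∃ u ∈ F, w ≤ u

theorem IsRealization.exists_iUnion [Countable T] {I : Type u} {ρ : I → T}
    (hinj : Function.Injective ρ)
    (hρ : ∀ i j w, w ≤ ρ i → w ≤ ρ j → i = j) {c : I → Ordinal.{u}} {φ : I → T → Ordinal.{u}}
    (h : ∀ i, IsRealization (Iic (ρ i)) (c i) (φ i)) :
    ∃ d ψ, natSum c ≤ d ∧ IsRealization (⋃ i, Iic (ρ i)) d ψ := by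
  classical
  have : Countable I := hinj.countable
  have hmem : ∀ i w, w ≤ ρ i → φ i w < c i := fun i w hw => (h i).bijOn.mapsTo hw
  obtain ⟨d, m, hd, hm, hfin⟩ := exists_isMerge_natSum c fun i =>
    (zero_le).trans_lt (hmem i (ρ i) le_rfl)
  -- The components are disjoint by `hρ`, so the chosen index is the only possible one.
  let ψ : T → Ordinal.{u} := fun w => if hw : ∃ i, w ≤ ρ i then m hw.choose (φ hw.choose w) else 0
  have hψ : ∀ i w, w ≤ ρ i → ψ w = m i (φ i w) := fun i w hw => by
    have hex : ∃ i, w ≤ ρ i := ⟨i, hw⟩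
    simp only [ψ, dif_pos hex, hρ _ i w hex.choose_spec hw]
  have hψlt : ∀ i w, w ≤ ρ i → ψ w < d := fun i w hw => by
    rw [hψ i w hw]
    exact hm.lt i (mem_univ i) _ (hmem i w hw)
  have hψle : ∀ i v w, v ≤ ρ i → w ≤ ρ i → (ψ v ≤ ψ w ↔ φ i v ≤ φ i w) := fun i v w hv hw => by
    rw [hψ i v hv, hψ i w hw]
    exact (hm.strictMonoOn i (mem_univ i)).le_iff_le (hmem i v hv) (hmem i w hw)
  refine ⟨d, ψ, hd, ⟨?_, ?_, ?_⟩, ?_, ?_⟩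
  · intro w hw
    obtain ⟨i, hi⟩ := mem_iUnion.1 hw
    exact hψlt i w hi
  · intro v hv w hw hvw
    obtain ⟨i, hi⟩ := mem_iUnion.1 hv
    obtain ⟨j, hj⟩ := mem_iUnion.1 hw
    have hij : i = j := by
      rw [hψ i v hi, hψ j w hj] at hvw
      exact hm.inj i (mem_univ i) j (mem_univ j) _ (hmem i v hi) _ (hmem j w hj) hvw
    subst hij
    exact (h i).bijOn.injOn hi hj
      (le_antisymm ((hψle i v w hi hj).1 hvw.le) ((hψle i w v hj hi).1 hvw.ge))
  · intro z hz
    obtain ⟨i, -, x, hx, rfl⟩ := hm.surj z hz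
    obtain ⟨w, hw, rfl⟩ := (h i).bijOn.surjOn hx
    exact ⟨w, mem_iUnion.2 ⟨i, hw⟩, hψ i w hw⟩
  · intro v _ w hw hvw
    obtain ⟨i, hi⟩ := mem_iUnion.1 hw
    exact (hψle i v w (hvw.trans hi) hi).2 ((h i).monotoneOn (hvw.trans hi) hi hvw)
  · intro v hv
    obtain ⟨i, hi⟩ := mem_iUnion.1 hv
    obtain ⟨F, hF, hvF⟩ := (h i).downward_finite v hi
    have hJ : {j | ∃ x < c j, m j x ≤ ψ v}.Finite := hfin _ (hψlt i v hi)
    -- Within its own component `v` keeps its witness `F`; each of the finitely many other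
    -- components reached by `ψ v` is covered by its top, which is incomparable with `v`.
    refine ⟨F ∪ (hJ.toFinset.erase i).image ρ, ?_, ?_⟩
    · intro u hu
      rcases Finset.mem_union.1 hu with hu | hu
      · exact ⟨mem_iUnion.2 ⟨i, (hF u hu).1⟩, (hF u hu).2⟩
      · obtain ⟨j, hj, rfl⟩ := Finset.mem_image.1 hu
        have hji : j ≠ i := (Finset.mem_erase.1 hj).1
        exact ⟨mem_iUnion.2 ⟨j, le_rfl⟩, fun hle => hji (hρ j i (ρ j) le_rfl (hle.trans hi)),
          fun hle => hji (hρ j i v hle hi)⟩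
    · intro w hw hwv
      obtain ⟨j, hj⟩ := mem_iUnion.1 hw
      by_cases hji : j = i
      · subst hji
        refine (hvF w hj ((hψle j w v hj hi).1 hwv)).imp_right ?_
        rintro ⟨u, hu, hwu⟩
        exact ⟨u, Finset.mem_union_left _ hu, hwu⟩
      · refine Or.inr ⟨ρ j, Finset.mem_union_right _ (Finset.mem_image_of_mem _
          (Finset.mem_erase.2 ⟨hji, hJ.mem_toFinset.2 ⟨φ j w, hmem j w hj, ?_⟩⟩)), hj⟩
        rwa [← hψ j w hj]

theorem IsRealization.exists_insert {t : T} {c : Ordinal.{u}} {φ : T → Ordinal.{u}}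
    (h : IsRealization (Iio t) c φ) : ∃ ψ, IsRealization (Iic t) (c + 1) ψ := by
  classical
  let ψ : T → Ordinal.{u} := fun w => if w = t then c else φ w
  have hψt : ψ t = c := if_pos rfl
  have hψ : ∀ w < t, ψ w = φ w := fun w hw => if_neg hw.ne
  have hlt : ∀ w < t, φ w < c := fun w hw => h.bijOn.mapsTo hw
  refine ⟨ψ, ⟨?_, ?_, ?_⟩, ?_, ?_⟩
  · intro w hw
    rcases (mem_Iic.1 hw).eq_or_lt with rfl | hw
    · rw [hψt]
      exact lt_add_one c
    · rw [hψ w hw]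
      exact (hlt w hw).trans (lt_add_one c)
  · intro v hv w hw hvw
    rcases (mem_Iic.1 hv).eq_or_lt with rfl | hv <;> rcases (mem_Iic.1 hw).eq_or_lt with rfl | hw
    · rfl
    · rw [hψt, hψ w hw] at hvw
      exact absurd hvw (hlt w hw).ne'
    · rw [hψt, hψ v hv] at hvw
      exact absurd hvw (hlt v hv).ne
    · rw [hψ v hv, hψ w hw] at hvw
      exact h.bijOn.injOn hv hw hvw
  · intro z hz
    rcases (Order.lt_add_one_iff.1 (mem_Iio.1 hz)).eq_or_lt with rfl | hz
    · exact ⟨t, le_rfl, hψt⟩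
    · obtain ⟨w, hw, rfl⟩ := h.bijOn.surjOn hz
      exact ⟨w, le_of_lt hw, hψ w hw⟩
  · intro v hv w hw hvw
    rcases (mem_Iic.1 hw).eq_or_lt with rfl | hw
    · rcases hvw.eq_or_lt with rfl | hv
      · rfl
      · rw [hψt, hψ v hv]
        exact (hlt v hv).le
    · rw [hψ v (hvw.trans_lt hw), hψ w hw]
      exact h.monotoneOn (hvw.trans_lt hw) hw hvw
  · intro v hv
    rcases (mem_Iic.1 hv).eq_or_lt with rfl | hv
    · exact ⟨∅, by simp, fun w hw _ => Or.inl hw⟩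
    · obtain ⟨F, hF, hvF⟩ := h.downward_finite v hv
      refine ⟨F, fun u hu => ⟨le_of_lt (hF u hu).1, (hF u hu).2⟩, fun w hw hwv => ?_⟩
      rcases (mem_Iic.1 hw).eq_or_lt with rfl | hw
      · rw [hψt, hψ v hv] at hwv
        exact absurd (hlt v hv) hwv.not_gt
      · rw [hψ v hv, hψ w hw] at hwv
        exact hvF w hw hwv

theorem exists_isRealization_Iic [WellFoundedLT T] [Countable T] (hT : IsReversedTree T) (t : T) :
    ∃ c φ, nodeSize t ≤ c ∧ IsRealization (Iic t) c φ := by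
  induction t using WellFoundedLT.induction with
  | ind t IH =>
    choose c φ hc hφ using fun u : {u : T // u ⋖ t} => IH u.1 u.2.lt
    obtain ⟨d, ψ, hd, hψ⟩ := IsRealization.exists_iUnion Subtype.val_injective
      (fun i j w hi hj => Subtype.ext (hT.eq_of_covBy i.2 j.2 hi hj)) hφ
    rw [hT.iUnion_Iic_covBy] at hψ
    obtain ⟨χ, hχ⟩ := hψ.exists_insert
    refine ⟨_, χ, ?_, hχ⟩
    rw [nodeSize]
    exact add_le_add_left ((natSum_mono hc).trans hd) 1

theorem exists_isRealization_univ [WellFoundedLT T] [Countable T] (hT : IsReversedTree T) :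
    ∃ c φ, size T ≤ c ∧ IsRealization (Set.univ : Set T) c φ := by
  choose c φ hc hφ using fun u : {u : T // IsMax u} => exists_isRealization_Iic hT u.1
  obtain ⟨d, ψ, hd, hψ⟩ := IsRealization.exists_iUnion Subtype.val_injective
    (fun i j w hi hj => Subtype.ext (hT.eq_of_isMax i.2 j.2 hi hj)) hφ
  rw [hT.iUnion_Iic_isMax] at hψ
  exact ⟨d, ψ, (natSum_mono hc).trans hd, hψ⟩

theorem IsRealization.exists_linearOrder {c : Ordinal.{u}} {φ : T → Ordinal.{u}}
    (h : IsRealization Set.univ c φ) : ∃ (L : LinearOrder T) (hL : IsWellOrder T L.lt),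
      IsDownwardFiniteExtension L.le ∧ c ≤ @Ordinal.type T L.lt hL := by
  have hinj : Function.Injective φ := fun x y => h.bijOn.injOn (mem_univ x) (mem_univ y)
  let L : LinearOrder T := LinearOrder.lift' φ hinj
  have hL : IsWellOrder T L.lt :=
    RelEmbedding.isWellOrder (⟨⟨φ, hinj⟩, Iff.rfl⟩ : L.lt ↪r ((· < ·) : Ordinal → Ordinal → Prop))
  refine ⟨L, hL, ⟨fun u t hut => h.monotoneOn (mem_univ u) (mem_univ t) hut, fun v => ?_⟩, ?_⟩
  · obtain ⟨F, hF, hvF⟩ := h.downward_finite v (mem_univ v)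
    refine ⟨F, fun u hu => (hF u hu).2, fun w hw => ?_⟩
    rcases hvF w (mem_univ w) hw with h | ⟨u, hu, hwu⟩
    · exact Or.inl h
    · exact Or.inr (mem_biUnion (show u ∈ F from hu) hwu)
  -- As `φ` is onto the ordinals below `c`, each ordinal below `φ x` is the value of some
  -- predecessor of `x`, so the rank of `x` is at least `φ x`.
  · have key : ∀ o, ∀ x, φ x = o → o ≤ @typein T L.lt hL x := by
      intro o
      induction o using WellFoundedLT.induction with
      | ind o IH =>
        rintro x rfl
        refine le_of_forall_lt fun o ho => ?_
        obtain ⟨y, -, rfl⟩ := h.bijOn.surjOn (ho.trans (h.bijOn.mapsTo (mem_univ x)) : o < c)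
        exact (IH _ ho y rfl).trans_lt ((@typein_lt_typein T L.lt hL y x).2 ho)
    refine le_of_forall_lt fun o ho => ?_
    obtain ⟨y, -, rfl⟩ := h.bijOn.surjOn ho
    exact (key _ y rfl).trans_lt (@typein_lt_type T L.lt hL y)

theorem IsDownwardFiniteExtension.type_le_size [WellFoundedLT T] (hT : IsReversedTree T)
    (L : LinearOrder T) (hL : IsWellOrder T L.lt) (h : IsDownwardFiniteExtension L.le) :
    @Ordinal.type T L.lt hL ≤ size T := by
  refine @TreeSize.type_le_size T _ L.lt hL _ hT ?_
  have : (fun x y : T => x = y ∨ L.lt x y) = L.le := by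
    ext x y
    exact (@le_iff_eq_or_lt T L.toPartialOrder x y).symm
  rwa [this]

end Realization

end TreeSize

theorem theorem6p3 (T : Type u) [PartialOrder T] [WellFoundedLT T] [Countable T]
    (hT : TreeSize.IsReversedTree T) :
    (∃ (L : LinearOrder T) (hL : IsWellOrder T L.lt),
      TreeSize.IsDownwardFiniteExtension L.le ∧
        @Ordinal.type T L.lt hL = TreeSize.size T) ∧
    (∀ (L : LinearOrder T) (hL : IsWellOrder T L.lt),
      TreeSize.IsDownwardFiniteExtension L.le →
        @Ordinal.type T L.lt hL ≤ TreeSize.size T) := by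
  refine ⟨?_, fun L hL h => h.type_le_size hT L hL⟩
  obtain ⟨c, φ, hc, hφ⟩ := TreeSize.exists_isRealization_univ hT
  obtain ⟨L, hL, hext, hle⟩ := hφ.exists_linearOrder
  exact ⟨L, hL, hext, le_antisymm (hext.type_le_size hT L hL) (hc.trans hle)⟩
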